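/- Let $D_\emptyset$ be a product probability measure on $\{\pm1\}^n$ with no fixed coordinates (every coordinate takes both values $\pm1$ with positive probability), and let $\mathcal S=\{D_u\}_{u\in S}$ be a family of product probability measures on $\{\pm1\}^n$ with a prior probability distribution $\mu$ on $S$. Write $\overline D_u(x)=D_u(x)/D_\emptyset(x)$ for the relative density and $\langle f,g\rangle=\mathbb E_{x\sim D_\emptyset}f(x)g(x)$. For $t\in\mathbb N$ let $\|\cdot\|$ be the norm of $L^2(D_\emptyset^{\otimes t})$, and let $\overline D_u^{\otimes t}(x_1,\dots,x_t)=\prod_{i\le t}\overline D_u(x_i)$. For a function $f$ of $m$ samples $x_1,\dots,x_m\in\{\pm1\}^n$, let $f^{\le d,k}$ be its orthogonal projection in $L^2(D_\emptyset^{\otimes m})$ to the span of the functions that have degree at most $d$ in each $x_i$ and nonzero degree in at most $k$ of the $x_i$'s. The $(d,k)$-$\mathrm{LDLR}_m$ is $\big\|\big(\mathbb E_{u\sim\mu}\overline D_u^{\otimes m}-1\big)^{\le d,k}\big\|$. For $M>0$ let the statistical dimension be $$\mathrm{SDA}(\mathcal S,M)=\max\Big\{q\in\mathbb N:\ \mathbb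 E_{u,v\sim\mu}\big[\,|\langle\overline D_u,\overline D_v\rangle-1|\ \big|\ A\big]\le\tfrac1M\ \text{ for all events }A\text{ with }\Pr_{u,v\sim\mu}(A)\ge\tfrac1{q^2}\Big\},$$ where $u,v$ are independent, $A$ ranges over events of the pair $(u,v)$, and the maximum is $\infty$ if there is no largest such $q$. **Theorem.** Let $k\ge2$ be an even integer, let $m\ge2$ be an integer, and let $C\ge0$ and $\varepsilon>0$ be real numbers. Suppose that $\big\|\mathbb E_{u\sim\mu}\overline D_u^{\otimes 2k}\big\|^2\le C^k$ and that the $(1,4k)$-$\mathrm{LDLR}_m$ is at most $\varepsilon$. Then for every integer $q\ge1$, $$\mathrm{SDA}\left(\mathcal S,\ \frac{m}{q^{2/k}\,\varepsilon^{1/k}\,k}\cdot\frac{1}{\varepsilon^{1/k}+\frac{16kC^{1/2}}{m}}\right)\ge q .$$ -/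

import Mathlib

open MeasureTheory ProbabilityTheory

/-- The hypercube `{±1}ⁿ`; `ℤˣ = {1, -1}`. -/
abbrev Cube (n : ℕ) : Type := Fin n → ℤˣ

instance instMeasurableSingletonClassSign : MeasurableSingletonClass ℤˣ where
  measurableSet_singleton s :=
    ⟨{(s : ℤ)}, MeasurableSet.of_discrete, by ext t; simp [Units.ext_iff]⟩

/-- `ν` is a product probability measure on `{±1}ⁿ`, i.e. its coordinates are independent. -/
def IsProductMeasure {n : ℕ} (ν : Measure (Cube n)) : Prop :=
  ∃ P : Fin n → Measure ℤˣ, (∀ i, IsProbabilityMeasure (P i)) ∧ ν = Measure.pi P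

/-- `ν` has no fixed coordinate: every coordinate takes both of the values `1` and `-1` with
positive probability. -/
def NoFixedCoord {n : ℕ} (ν : Measure (Cube n)) : Prop :=
  ∀ (i : Fin n) (s : ℤˣ), 0 < ν {x | x i = s}

section Finite

variable {X : Type*} [MeasurableSpace X]

/-- The relative density `x ↦ P(x) / ν(x)` of `P` with respect to `ν`, for measures on a finite
(discrete) space. -/
noncomputable def relDensity (ν P : Measure X) (x : X) : ℝ := P.real {x} / ν.real {x}

/-- The inner product `⟨f, g⟩ = E_{x ∼ ν} f(x) g(x)`. -/
noncomputable def innerL2 (ν : Measure X) (f g : X → ℝ) : ℝ := ∫ x, f x * g x ∂ν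

/-- The distribution of `m` independent samples from `ν`. -/
noncomputable def samples (m : ℕ) (ν : Measure X) : Measure (Fin m → X) :=
  Measure.pi fun _ => ν

instance instIsProbabilityMeasureSamples [Finite X] (m : ℕ) (ν : Measure X) [IsProbabilityMeasure ν] :
    IsProbabilityMeasure (samples m ν) := by
  unfold samples; infer_instance

/-- A function on a finite probability space, as an element of the Hilbert space `L²(ν)`. -/
noncomputable def toL2 [Finite X] [DiscreteMeasurableSpace X] (ν : Measure X) [IsFiniteMeasure ν] :
    (X → ℝ) →ₗ[ℝ] Lp ℝ 2 ν where
  toFun f := (MemLp.of_discrete : MemLp f 2 ν).toLp f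
  map_add' _ _ := MemLp.toLp_add _ _
  map_smul' c _ := MemLp.toLp_const_smul c _

variable {S : Type*} [MeasurableSpace S]

/-- The `m`-sample likelihood ratio `E_{u ∼ μ} D̄_u^{⊗ m}` of the mixture of the `D u`, with
respect to `ν`. -/
noncomputable def mixtureLR (ν : Measure X) (D : Kernel S X) (μ : Measure S) (m : ℕ) :
    (Fin m → X) → ℝ :=
  fun x => ∫ u, ∏ j, relDensity ν (D u) (x j) ∂μ

/-- The statistical dimension `SDA(S, μ, M)`, for `M > 0`: the largest `q ∈ ℕ` (`⊤` if there is no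
largest) such that `E_{u,v ∼ μ} [ |⟨D̄_u, D̄_v⟩ - 1| | A ] ≤ 1 / M` for all events `A` of pairs
`(u, v)` with `Pr(A) ≥ 1 / q²`. -/
noncomputable def SDA (ν : Measure X) (D : Kernel S X) (μ : Measure S) (M : ℝ) : ℕ∞ :=
  ⨆ (q : ℕ) (_ : ∀ A : Set (S × S), MeasurableSet A → 1 / (q : ENNReal) ^ 2 ≤ (μ.prod μ) A →
      ∫ p, |innerL2 ν (relDensity ν (D p.1)) (relDensity ν (D p.2)) - 1| ∂((μ.prod μ)[|A])
        ≤ 1 / M),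
    (q : ℕ∞)

end Finite

/-- The functions of samplewise degree `(d, k)` of `m` samples `x₁, …, x_m ∈ {±1}ⁿ`: the linear
combinations of monomials `∏ᵢⱼ xᵢⱼ ^ sᵢⱼ` that have degree at most `d` in each sample `xᵢ` and
nonzero degree in at most `k` of the samples. -/
noncomputable def samplewiseDegree (n m d k : ℕ) : Submodule ℝ ((Fin m → Cube n) → ℝ) :=
  Submodule.span ℝ {f | ∃ s : Fin m → Fin n → ℕ,
    (∀ i, ∑ j, s i j ≤ d) ∧ {i | ∑ j, s i j ≠ 0}.ncard ≤ k ∧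
      f = fun x => ∏ i, ∏ j, (((x i j : ℤˣ) : ℤ) : ℝ) ^ s i j}

/-- `f^{≤ d, k}`: the orthogonal projection, in `L²(ν^{⊗ m})`, of `f` to the functions of
samplewise degree `(d, k)`. -/
noncomputable def lowDegreePart {n m : ℕ} (ν : Measure (Cube n)) [IsProbabilityMeasure ν]
    (d k : ℕ) (f : (Fin m → Cube n) → ℝ) : Lp ℝ 2 (samples m ν) :=
  ((samplewiseDegree n m d k).map (toL2 (samples m ν))).starProjection (toL2 (samples m ν) f)

/-- The `(d, k)`-`LDLR_m`, i.e. the norm in `L²(ν^{⊗ m})` of the `m`-sample `(d, k)`-low degree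
likelihood ratio function `(E_{u ∼ μ} D̄_u^{⊗ m} - 1)^{≤ d, k}`. -/
noncomputable def LDLR {n : ℕ} {S : Type*} [MeasurableSpace S] (ν : Measure (Cube n))
    [IsProbabilityMeasure ν] (D : Kernel S (Cube n)) (μ : Measure S) (m d k : ℕ) : ℝ :=
  ‖lowDegreePart ν d k (mixtureLR ν D μ m - 1)‖

/-!
Write `a_i(u)` for the mean under `D u` of the `i`-th coordinate, standardized with respect to `ν`
(`bias`). As all measures are products, `D u` has relative density `∏ i, (1 + a_i(u) z_i)` in the
standardized coordinates `z_i`, and the inner product of the densities of `D u` and `D v` is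
`P = ∏ i, (1 + c_i)` with `c_i = a_i(u) a_i(v)`. Let `y = ∑ i, c_i` (`overlap`).

The low-degree hypothesis bounds the moments of `y`: the part of the likelihood ratio that has degree
exactly one in each of exactly `j` samples has squared norm `(m choose j) E y ^ j`, which is therefore
at most `ε ^ 2` (`choose_mul_integral_overlap_pow_le`). The other hypothesis is
`E P ^ (2 k) ≤ C ^ k` (`norm_mixtureLR_sq`).

To pass from `y` to `P`, note that a polynomial in the `c_i` with nonnegative coefficients has
nonnegative expectation, since `E φ(u) φ(v) = (E φ)²`. The cone `positiveKernels` consists of such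
functions. In the order that it defines, `0 ≤ P - 1 ≤ y P` and `0 ≤ P - 1 - y ≤ y² P`
(`prod_one_add_mem_cone`), and these inequalities survive taking powers. If `4 k ≤ m`, then
Cauchy-Schwarz gives `E (P - 1 - y) ^ k ≤ E y ^ (2 k) P ^ k ≤ (E y ^ (4 k) E P ^ (2 k)) ^ (1/2)`, and
`E y ^ k` is bounded directly. If `m < 4 k`, then
`E (P - 1) ^ k ≤ E y P ^ k ≤ (E y ^ 2 E P ^ (2 k)) ^ (1/2)` is already small enough. By Jensen's
inequality, conditioning on an event of probability at least `1 / q ^ 2` costs a factor `q ^ (2 / k)`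
in these `L^k` bounds (`integral_abs_cond_le`).
-/

/-! ### Differences of products in an abstract positive cone -/

section Cone

variable {R ι : Type*} [CommRing R] (K : Subsemiring R)

lemma pow_sub_pow_mem_cone {f g : R} (hf : f ∈ K) (hfg : g - f ∈ K) (k : ℕ) :
    g ^ k - f ^ k ∈ K := by
  have hg : g ∈ K := by simpa using K.add_mem hfg hf
  induction k with
  | zero => simp
  | succ k ih =>
    have : g ^ (k + 1) - f ^ (k + 1) = g ^ k * (g - f) + (g ^ k - f ^ k) * f := by ring
    rw [this]
    exact K.add_mem (K.mul_mem (K.pow_mem hg k) hfg) (K.mul_mem ih hf)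

/-- In the order given by a cone `K`, elements `c i` of `K` with sum `y` and `P = ∏ (1 + c i)`
satisfy `0 ≤ P - 1 ≤ y P` and `0 ≤ P - 1 - y ≤ y² P`: every monomial of `P` of degree at least one
(at least two) is a product of one (two) of the `c i` with another monomial of `P`. -/
lemma prod_one_add_mem_cone (s : Finset ι) (c : ι → R) (hc : ∀ i ∈ s, c i ∈ K) :
    ∏ i ∈ s, (1 + c i) - 1 ∈ K ∧
    ∏ i ∈ s, (1 + c i) - 1 - ∑ i ∈ s, c i ∈ K ∧
    (∑ i ∈ s, c i) * ∏ i ∈ s, (1 + c i) - (∏ i ∈ s, (1 + c i) - 1) ∈ K ∧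
    (∑ i ∈ s, c i) ^ 2 * ∏ i ∈ s, (1 + c i) -
      (∏ i ∈ s, (1 + c i) - 1 - ∑ i ∈ s, c i) ∈ K := by
  classical
  induction s using Finset.induction_on with
  | empty => simp
  | insert a s ha ih =>
    obtain ⟨h1, h2, h3, h4⟩ := ih fun i hi => hc i (Finset.mem_insert_of_mem hi)
    have hca : c a ∈ K := hc a (Finset.mem_insert_self a s)
    have hy : ∑ i ∈ s, c i ∈ K := K.sum_mem fun i hi => hc i (Finset.mem_insert_of_mem hi)
    rw [Finset.prod_insert ha, Finset.sum_insert ha]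
    set P := ∏ i ∈ s, (1 + c i)
    set y := ∑ i ∈ s, c i
    set b := c a
    have hP : P ∈ K := by simpa using K.add_mem h1 K.one_mem
    have hbP : b * P ∈ K := K.mul_mem hca hP
    have hbyP : b * (y * P) ∈ K := K.mul_mem hca (K.mul_mem hy hP)
    refine ⟨?_, ?_, ?_, ?_⟩
    · rw [show (1 + b) * P - 1 = (P - 1) + b * P by ring]
      exact K.add_mem h1 hbP
    · rw [show (1 + b) * P - 1 - (b + y) = (P - 1 - y) + b * (P - 1) by ring]
      exact K.add_mem h2 (K.mul_mem hca h1)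
    · rw [show (b + y) * ((1 + b) * P) - ((1 + b) * P - 1)
          = (y * P - (P - 1)) + (b * (b * P) + b * (y * P)) by ring]
      exact K.add_mem h3 (K.add_mem (K.mul_mem hca hbP) hbyP)
    · rw [show (b + y) ^ 2 * ((1 + b) * P) - ((1 + b) * P - 1 - (b + y))
          = (y ^ 2 * P - (P - 1 - y)) + (b * (y * P - (P - 1)) + (b * (y * (y * P)) + (b * (y * P)
            + (b * (b * (y * P)) + b * (b * (y * P)) + (b * (b * P) + b * (b * (b * P))))))) by
          ring]
      exact K.add_mem h4 <| K.add_mem (K.mul_mem hca h3) <|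
        K.add_mem (K.mul_mem hca (K.mul_mem hy (K.mul_mem hy hP))) <| K.add_mem hbyP <|
        K.add_mem (K.add_mem (K.mul_mem hca hbyP) (K.mul_mem hca hbyP)) <|
        K.add_mem (K.mul_mem hca hbP) (K.mul_mem hca (K.mul_mem hca hbP))

end Cone

/-! ### Bounded measurable functions -/

section BoundedMeasurable

/-- The algebra of bounded measurable real functions. -/
def boundedMeasurable (α : Type*) [MeasurableSpace α] : Subalgebra ℝ (α → ℝ) where
  carrier := {f | Measurable f ∧ ∃ B : ℝ, ∀ x, |f x| ≤ B}
  mul_mem' := by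
    rintro f g ⟨hf, B, hB⟩ ⟨hg, B', hB'⟩
    refine ⟨hf.mul hg, B * B', fun x => ?_⟩
    rw [Pi.mul_apply, abs_mul]
    exact mul_le_mul (hB x) (hB' x) (abs_nonneg _) ((abs_nonneg _).trans (hB x))
  add_mem' := by
    rintro f g ⟨hf, B, hB⟩ ⟨hg, B', hB'⟩
    exact ⟨hf.add hg, B + B', fun x => (abs_add_le _ _).trans (add_le_add (hB x) (hB' x))⟩
  algebraMap_mem' r := ⟨measurable_const, |r|, fun x => le_rfl⟩

variable {α β : Type*} [MeasurableSpace α] [MeasurableSpace β]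

lemma integrable_of_mem_boundedMeasurable {f : α → ℝ} (hf : f ∈ boundedMeasurable α)
    (μ : Measure α) [IsFiniteMeasure μ] : Integrable f μ := by
  obtain ⟨hm, B, hB⟩ := hf
  exact Integrable.of_bound hm.aestronglyMeasurable B (Filter.Eventually.of_forall hB)

lemma abs_mem_boundedMeasurable {f : α → ℝ} (hf : f ∈ boundedMeasurable α) :
    (fun x => |f x|) ∈ boundedMeasurable α := by
  obtain ⟨hm, B, hB⟩ := hf
  exact ⟨hm.abs, B, fun x => by simpa using hB x⟩

lemma comp_mem_boundedMeasurable {f : α → ℝ} (hf : f ∈ boundedMeasurable α) {g : β → α}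
    (hg : Measurable g) : (fun x => f (g x)) ∈ boundedMeasurable β := by
  obtain ⟨hm, B, hB⟩ := hf
  exact ⟨hm.comp hg, B, fun x => hB _⟩

lemma const_mem_boundedMeasurable (r : ℝ) : (fun _ => r) ∈ boundedMeasurable α :=
  (boundedMeasurable α).algebraMap_mem r

lemma mul_mem_boundedMeasurable {f g : α → ℝ} (hf : f ∈ boundedMeasurable α)
    (hg : g ∈ boundedMeasurable α) : (fun x => f x * g x) ∈ boundedMeasurable α :=
  (boundedMeasurable α).mul_mem hf hg

lemma sum_mem_boundedMeasurable {ι : Type*} (s : Finset ι) {f : ι → α → ℝ}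
    (hf : ∀ i ∈ s, f i ∈ boundedMeasurable α) :
    (fun x => ∑ i ∈ s, f i x) ∈ boundedMeasurable α := by
  simpa only [Finset.sum_fn] using (boundedMeasurable α).sum_mem hf

lemma prod_mem_boundedMeasurable {ι : Type*} (s : Finset ι) {f : ι → α → ℝ}
    (hf : ∀ i ∈ s, f i ∈ boundedMeasurable α) :
    (fun x => ∏ i ∈ s, f i x) ∈ boundedMeasurable α := by
  have := (boundedMeasurable α).prod_mem hf
  rwa [show ∏ i ∈ s, f i = fun x => ∏ i ∈ s, f i x by ext; simp] at this

/-- Cauchy-Schwarz. -/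
lemma integral_mul_le_sqrt_mul_sqrt {f g : α → ℝ} (hf : f ∈ boundedMeasurable α)
    (hg : g ∈ boundedMeasurable α) (μ : Measure α) [IsFiniteMeasure μ] :
    ∫ x, f x * g x ∂μ ≤ √(∫ x, f x ^ 2 ∂μ) * √(∫ x, g x ^ 2 ∂μ) := by
  have hf' := abs_mem_boundedMeasurable hf
  have hg' := abs_mem_boundedMeasurable hg
  have hL {h : α → ℝ} (hh : h ∈ boundedMeasurable α) : MemLp h (ENNReal.ofReal 2) μ := by
    obtain ⟨hm, B, hB⟩ := hh
    exact MemLp.of_bound hm.aestronglyMeasurable B (Filter.Eventually.of_forall hB)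
  have h := integral_mul_le_Lp_mul_Lq_of_nonneg (μ := μ) Real.HolderConjugate.two_two
    (Filter.Eventually.of_forall fun x => abs_nonneg (f x))
    (Filter.Eventually.of_forall fun x => abs_nonneg (g x)) (hL hf') (hL hg')
  simp only [Real.rpow_two, sq_abs, ← Real.sqrt_eq_rpow] at h
  refine le_trans (integral_mono (integrable_of_mem_boundedMeasurable
    (mul_mem_boundedMeasurable hf hg) μ) (integrable_of_mem_boundedMeasurable
    (mul_mem_boundedMeasurable hf' hg') μ) fun x => ?_) h
  simpa only [abs_mul] using le_abs_self (f x * g x)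

/-- Conditioning on an event of probability at least `1 / q²` increases an `L^k` bound by a factor
of at most `q^(2/k)`. -/
lemma integral_abs_cond_le {μ : Measure α} [IsProbabilityMeasure μ] {f : α → ℝ}
    (hf : f ∈ boundedMeasurable α) {k q : ℕ} (hk : 0 < k) (hkeven : Even k) (hq : 1 ≤ q) {B : ℝ}
    (hB : 0 ≤ B) (hfB : ∫ x, f x ^ k ∂μ ≤ B ^ k) {A : Set α}
    (hA : 1 / (q : ENNReal) ^ 2 ≤ μ A) :
    ∫ x, |f x| ∂(μ[|A]) ≤ (q : ℝ) ^ (2 / k : ℝ) * B := by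
  have hA0 : μ A ≠ 0 := by
    intro h0
    rw [h0, nonpos_iff_eq_zero, ENNReal.div_eq_zero_iff] at hA
    simp at hA
  have : IsProbabilityMeasure (μ[|A]) := cond_isProbabilityMeasure hA0
  have hint (ρ : Measure α) [IsFiniteMeasure ρ] : Integrable (fun x => |f x|) ρ :=
    integrable_of_mem_boundedMeasurable (abs_mem_boundedMeasurable hf) ρ
  have hintk (ρ : Measure α) [IsFiniteMeasure ρ] : Integrable (fun x => f x ^ k) ρ :=
    integrable_of_mem_boundedMeasurable ((boundedMeasurable α).pow_mem hf k) ρ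
  have hk0 : (k : ℝ) ≠ 0 := by positivity
  have hjensen : (∫ x, |f x| ∂(μ[|A])) ^ k ≤ ∫ x, f x ^ k ∂(μ[|A]) := by
    have h := (convexOn_pow k).map_integral_le (μ := μ[|A]) (f := fun x => |f x|)
      (continuous_pow k).continuousOn isClosed_Ici
      (Filter.Eventually.of_forall fun x => abs_nonneg (f x)) (hint _)
      (by simpa only [Function.comp_def, hkeven.pow_abs] using hintk _)
    simpa only [hkeven.pow_abs] using h
  have hcond : ∫ x, f x ^ k ∂(μ[|A]) ≤ (q : ℝ) ^ 2 * ∫ x, f x ^ k ∂μ := by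
    rw [ProbabilityTheory.cond, integral_smul_measure, smul_eq_mul]
    have hnn : 0 ≤ᵐ[μ] fun x => f x ^ k := Filter.Eventually.of_forall fun x => hkeven.pow_nonneg _
    refine mul_le_mul ?_ (setIntegral_le_integral (hintk μ) hnn)
      (integral_nonneg fun x => hkeven.pow_nonneg _) (by positivity)
    have h1 : (μ A)⁻¹ ≤ (q : ENNReal) ^ 2 := by
      rw [ENNReal.inv_le_iff_inv_le]
      simpa using hA
    simpa using ENNReal.toReal_mono (by simp) h1
  have hpow : ((q : ℝ) ^ (2 / k : ℝ) * B) ^ k = (q : ℝ) ^ 2 * B ^ k := by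
    rw [mul_pow, ← Real.rpow_natCast ((q : ℝ) ^ (2 / k : ℝ)), ← Real.rpow_mul (by positivity),
      div_mul_cancel₀ _ hk0, Real.rpow_two]
  refine le_of_pow_le_pow_left₀ hk.ne' (by positivity) ?_
  rw [hpow]
  exact hjensen.trans (hcond.trans (mul_le_mul_of_nonneg_left hfB (by positivity)))

end BoundedMeasurable

/-! ### Positive-definite kernels -/

section PositiveKernels

variable {S : Type*} [MeasurableSpace S]

/-- The cone of functions `F` on `S × S` that are finite sums of functions `(u, v) ↦ φ u * φ v`
with `φ` bounded and measurable. As such functions are closed under products, this is the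
subsemiring that they generate. -/
def positiveKernels (S : Type*) [MeasurableSpace S] : Subsemiring (S × S → ℝ) :=
  Subsemiring.closure {F | ∃ φ ∈ boundedMeasurable S, F = fun p => φ p.1 * φ p.2}

lemma mul_self_mem_positiveKernels {φ : S → ℝ} (hφ : φ ∈ boundedMeasurable S) :
    (fun p : S × S => φ p.1 * φ p.2) ∈ positiveKernels S :=
  Subsemiring.subset_closure ⟨φ, hφ, rfl⟩

lemma positiveKernels_le_boundedMeasurable {F : S × S → ℝ} (hF : F ∈ positiveKernels S) :
    F ∈ boundedMeasurable (S × S) := by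
  refine (Subsemiring.closure_le (t := (boundedMeasurable (S × S)).toSubsemiring)).2 ?_ hF
  rintro _ ⟨φ, hφ, rfl⟩
  exact mul_mem_boundedMeasurable (comp_mem_boundedMeasurable hφ measurable_fst)
    (comp_mem_boundedMeasurable hφ measurable_snd)

/-- For independent `u, v` with the same distribution, `E φ(u) φ(v) = (E φ)²`. -/
lemma integral_nonneg_of_mem_positiveKernels {F : S × S → ℝ} (hF : F ∈ positiveKernels S)
    (μ : Measure S) [IsProbabilityMeasure μ] : 0 ≤ ∫ p, F p ∂(μ.prod μ) := by
  let M : Submonoid (S × S → ℝ) :=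
    { carrier := {F | ∃ φ ∈ boundedMeasurable S, F = fun p => φ p.1 * φ p.2}
      one_mem' := ⟨1, one_mem _, by ext; simp⟩
      mul_mem' := by
        rintro _ _ ⟨φ, hφ, rfl⟩ ⟨ψ, hψ, rfl⟩
        exact ⟨φ * ψ, mul_mem hφ hψ, by ext; simp; ring⟩ }
  have hF' : F ∈ AddSubmonoid.closure (M : Set (S × S → ℝ)) := by
    rw [← Submonoid.subsemiringClosure_mem, Submonoid.subsemiringClosure_eq_closure]
    exact hF
  clear hF
  have key : F ∈ boundedMeasurable (S × S) ∧ 0 ≤ ∫ p, F p ∂(μ.prod μ) := by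
    induction hF' using AddSubmonoid.closure_induction with
    | mem F hF =>
      refine ⟨positiveKernels_le_boundedMeasurable (Subsemiring.subset_closure hF), ?_⟩
      obtain ⟨φ, -, rfl⟩ := hF
      rw [integral_prod_mul φ φ]
      exact mul_self_nonneg _
    | zero => exact ⟨zero_mem _, by simp⟩
    | add F G _ _ hF hG =>
      obtain ⟨hF, hF0⟩ := hF
      obtain ⟨hG, hG0⟩ := hG
      refine ⟨add_mem hF hG, ?_⟩
      simp only [Pi.add_apply]
      rw [integral_add (integrable_of_mem_boundedMeasurable hF _)
        (integrable_of_mem_boundedMeasurable hG _)]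
      exact add_nonneg hF0 hG0
  exact key.2

lemma integral_mono_of_sub_mem_positiveKernels {F G : S × S → ℝ}
    (hF : F ∈ boundedMeasurable (S × S)) (hG : G ∈ boundedMeasurable (S × S))
    (hFG : G - F ∈ positiveKernels S) (μ : Measure S) [IsProbabilityMeasure μ] :
    ∫ p, F p ∂(μ.prod μ) ≤ ∫ p, G p ∂(μ.prod μ) := by
  have h := integral_nonneg_of_mem_positiveKernels hFG μ
  simp only [Pi.sub_apply] at h
  rw [integral_sub (integrable_of_mem_boundedMeasurable hG _)
    (integrable_of_mem_boundedMeasurable hF _)] at h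
  linarith

end PositiveKernels

/-! ### A lower bound for binomial coefficients -/

lemma div_pow_le_choose (m j : ℕ) (hj : j ≤ m) : ((m : ℝ) / j) ^ j ≤ m.choose j := by
  induction j generalizing m with
  | zero => simp
  | succ j ih =>
    obtain ⟨m, rfl⟩ : ∃ l, m = l + 1 := ⟨m - 1, by omega⟩
    have hjm : j ≤ m := by omega
    have h1 : ((m + 1 : ℝ) / (j + 1)) ^ j ≤ ((m : ℝ) / j) ^ j := by
      rcases Nat.eq_zero_or_pos j with rfl | hj0
      · simp
      · have hjm' : (j : ℝ) ≤ m := by exact_mod_cast hjm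
        gcongr 1
        rw [div_le_div_iff₀ (by positivity) (by positivity)]
        nlinarith
    have h2 : ((m + 1).choose (j + 1) : ℝ) = (m + 1) / (j + 1) * m.choose j := by
      have : ((m + 1 : ℕ) : ℝ) * m.choose j = (m + 1).choose (j + 1) * ((j + 1 : ℕ) : ℝ) := by
        exact_mod_cast Nat.add_one_mul_choose_eq m j
      push_cast at this
      field_simp
      linarith
    rw [h2, pow_succ']
    push_cast
    exact mul_le_mul_of_nonneg_left (h1.trans (ih m hjm)) (by positivity)

/-! ### Standardized coordinates of a product measure on the cube -/

section Cube

variable {n : ℕ}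

/-- The mean of the `i`-th coordinate under `ν`. -/
noncomputable def coordMean (ν : Measure (Cube n)) (i : Fin n) : ℝ :=
  ∫ x, (((x i : ℤˣ) : ℤ) : ℝ) ∂ν

/-- The `i`-th coordinate, standardized so as to have mean zero and variance one under `ν`. -/
noncomputable def stdCoord (ν : Measure (Cube n)) (i : Fin n) (x : Cube n) : ℝ :=
  ((((x i : ℤˣ) : ℤ) : ℝ) - coordMean ν i) / √(1 - coordMean ν i ^ 2)

/-- The mean under `P` of the `i`-th coordinate standardized with respect to `ν`. -/
noncomputable def bias (ν P : Measure (Cube n)) (i : Fin n) : ℝ := ∫ x, stdCoord ν i x ∂P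

/-- The part of degree one of the relative density of `P` with respect to `ν`. -/
noncomputable def linearPart (ν P : Measure (Cube n)) (x : Cube n) : ℝ :=
  ∑ i, bias ν P i * stdCoord ν i x

lemma sq_sign (s : ℤˣ) : ((s : ℤ) : ℝ) ^ 2 = 1 := by
  rcases Int.units_eq_one_or s with rfl | rfl <;> simp

lemma real_singleton_sign (P : Measure ℤˣ) [IsProbabilityMeasure P] (s : ℤˣ) :
    P.real {s} = (1 + ((s : ℤ) : ℝ) * ∫ t, ((t : ℤ) : ℝ) ∂P) / 2 := by
  have huniv : (Finset.univ : Finset ℤˣ) = {1, -1} := by decide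
  have hne : (1 : ℤˣ) ∉ ({-1} : Finset ℤˣ) := by decide
  have h1 : P.real {1} + P.real {-1} = 1 := by
    have h := integral_fintype (μ := P) (f := fun _ : ℤˣ => (1 : ℝ)) .of_finite
    rw [huniv, Finset.sum_insert hne] at h
    simpa using h.symm
  have h2 : ∫ t, ((t : ℤ) : ℝ) ∂P = P.real {1} - P.real {-1} := by
    rw [integral_fintype .of_finite, huniv, Finset.sum_insert hne]
    simp [sub_eq_add_neg]
  rw [h2]
  rcases Int.units_eq_one_or s with rfl | rfl <;> simp <;> linarith

lemma integral_pi_eval (P : Fin n → Measure ℤˣ) [∀ i, IsProbabilityMeasure (P i)] (i : Fin n)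
    (g : ℤˣ → ℝ) : ∫ x, g (x i) ∂(Measure.pi P) = ∫ s, g s ∂(P i) := by
  rw [← (measurePreserving_eval P i).map_eq, integral_map (measurable_pi_apply i).aemeasurable
    Measurable.of_discrete.aestronglyMeasurable]

lemma real_singleton_of_isProductMeasure {P : Measure (Cube n)} (hP : IsProductMeasure P)
    (x : Cube n) : P.real {x} = ∏ i, (1 + (((x i : ℤˣ) : ℤ) : ℝ) * coordMean P i) / 2 := by
  obtain ⟨P, hP1, rfl⟩ := hP
  rw [measureReal_def, Measure.pi_singleton, ENNReal.toReal_prod]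
  refine Finset.prod_congr rfl fun i _ => ?_
  rw [← measureReal_def, real_singleton_sign, coordMean, integral_pi_eval P i fun s => ((s : ℤ) : ℝ)]

lemma integral_prod_of_isProductMeasure {P : Measure (Cube n)} (hP : IsProductMeasure P)
    (g : Fin n → ℤˣ → ℝ) : ∫ x, ∏ i, g i (x i) ∂P = ∏ i, ∫ x, g i (x i) ∂P := by
  obtain ⟨P, hP1, rfl⟩ := hP
  rw [integral_fintype_prod_eq_prod]
  exact Finset.prod_congr rfl fun i _ => (integral_pi_eval P i (g i)).symm

lemma integral_mul_of_isProductMeasure {P : Measure (Cube n)} (hP : IsProductMeasure P)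
    {i j : Fin n} (hij : i ≠ j) (f g : ℤˣ → ℝ) :
    ∫ x, f (x i) * g (x j) ∂P = (∫ x, f (x i) ∂P) * ∫ x, g (x j) ∂P := by
  obtain ⟨P, hP1, rfl⟩ := hP
  have h : iIndepFun (fun i (x : Cube n) => x i) (Measure.pi P) :=
    iIndepFun_pi (X := fun _ s => s) fun i => measurable_id.aemeasurable
  exact ((h.indepFun hij).comp (φ := f) (ψ := g) .of_discrete .of_discrete)
    |>.integral_fun_mul_eq_mul_integral Measurable.of_discrete.aestronglyMeasurable
      Measurable.of_discrete.aestronglyMeasurable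

lemma integral_stdCoord (ν P : Measure (Cube n)) [IsProbabilityMeasure P] (i : Fin n) :
    ∫ x, stdCoord ν i x ∂P = (coordMean P i - coordMean ν i) / √(1 - coordMean ν i ^ 2) := by
  simp only [stdCoord]
  rw [integral_div, integral_sub .of_finite .of_finite]
  simp [coordMean]

lemma integral_linearPart (ν Q P : Measure (Cube n)) [IsProbabilityMeasure Q] :
    ∫ x, linearPart ν P x ∂Q = ∑ i, bias ν P i * bias ν Q i := by
  simp only [linearPart]
  rw [integral_finsetSum _ fun _ _ => .of_finite]
  exact Finset.sum_congr rfl fun i _ => integral_const_mul _ _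

lemma isProbabilityMeasure_of_isProductMeasure {P : Measure (Cube n)} (hP : IsProductMeasure P) :
    IsProbabilityMeasure P := by
  obtain ⟨P, hP1, rfl⟩ := hP
  infer_instance

variable {ν : Measure (Cube n)} [IsProbabilityMeasure ν]

lemma one_add_sign_mul_coordMean_pos (hν : IsProductMeasure ν) (hfix : NoFixedCoord ν)
    (i : Fin n) (s : ℤˣ) : 0 < 1 + ((s : ℤ) : ℝ) * coordMean ν i := by
  obtain ⟨P, hP1, rfl⟩ := hν
  have h1 : (Measure.pi P) {x | x i = s} = P i {s} :=
    (measurePreserving_eval P i).measure_preimage (measurableSet_singleton s).nullMeasurableSet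
  have h2 : 0 < (P i).real {s} := by
    rw [measureReal_def, ← h1]
    exact ENNReal.toReal_pos (hfix i s).ne' (measure_ne_top _ _)
  rw [real_singleton_sign] at h2
  rw [coordMean, integral_pi_eval P i fun s => ((s : ℤ) : ℝ)]
  linarith

lemma one_sub_coordMean_sq_pos (hν : IsProductMeasure ν) (hfix : NoFixedCoord ν) (i : Fin n) :
    0 < 1 - coordMean ν i ^ 2 := by
  have h1 := one_add_sign_mul_coordMean_pos hν hfix i 1
  have h2 := one_add_sign_mul_coordMean_pos hν hfix i (-1)
  simp only [Units.val_one, Units.val_neg, Int.cast_one, Int.cast_neg] at h1 h2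
  nlinarith

/-- A probability measure on `{±1}` has a density that is affine in the coordinate. -/
lemma relDensity_eq_prod (hν : IsProductMeasure ν) (hfix : NoFixedCoord ν) {P : Measure (Cube n)}
    (hP : IsProductMeasure P) (x : Cube n) :
    relDensity ν P x = ∏ i, (1 + bias ν P i * stdCoord ν i x) := by
  have := isProbabilityMeasure_of_isProductMeasure hP
  rw [relDensity, real_singleton_of_isProductMeasure hν, real_singleton_of_isProductMeasure hP,
    ← Finset.prod_div_distrib]
  refine Finset.prod_congr rfl fun i _ => ?_
  have h1 := one_add_sign_mul_coordMean_pos hν hfix i (x i)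
  have h2 := one_sub_coordMean_sq_pos hν hfix i
  rw [bias, integral_stdCoord, stdCoord, div_mul_div_comm, Real.mul_self_sqrt h2.le]
  have hs := sq_sign (x i)
  set s : ℝ := (((x i : ℤˣ) : ℤ) : ℝ)
  field_simp
  linear_combination (coordMean ν i ^ 2 - coordMean ν i * coordMean P i) * hs

lemma integral_relDensity_mul (hν : IsProductMeasure ν) (hfix : NoFixedCoord ν)
    (P : Measure (Cube n)) [IsProbabilityMeasure P] (f : Cube n → ℝ) :
    ∫ x, relDensity ν P x * f x ∂ν = ∫ x, f x ∂P := by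
  rw [integral_fintype .of_finite, integral_fintype .of_finite]
  refine Finset.sum_congr rfl fun x _ => ?_
  have : ν.real {x} ≠ 0 := by
    rw [real_singleton_of_isProductMeasure hν]
    exact Finset.prod_ne_zero_iff.2 fun i _ =>
      (half_pos (one_add_sign_mul_coordMean_pos hν hfix i (x i))).ne'
  simp only [relDensity, smul_eq_mul]
  field_simp

lemma integral_relDensity (hν : IsProductMeasure ν) (hfix : NoFixedCoord ν)
    (P : Measure (Cube n)) [IsProbabilityMeasure P] : ∫ x, relDensity ν P x ∂ν = 1 := by
  simpa using integral_relDensity_mul hν hfix P fun _ => 1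

lemma innerL2_relDensity (hν : IsProductMeasure ν) (hfix : NoFixedCoord ν)
    {P Q : Measure (Cube n)} (hP : IsProductMeasure P) (hQ : IsProductMeasure Q) :
    innerL2 ν (relDensity ν P) (relDensity ν Q) = ∏ i, (1 + bias ν P i * bias ν Q i) := by
  have := isProbabilityMeasure_of_isProductMeasure hP
  rw [innerL2, integral_relDensity_mul hν hfix P]
  simp_rw [relDensity_eq_prod hν hfix hQ]
  refine (integral_prod_of_isProductMeasure hP fun i s => 1 + bias ν Q i *
    ((((s : ℤˣ) : ℤ) - coordMean ν i) / √(1 - coordMean ν i ^ 2))).trans ?_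
  refine Finset.prod_congr rfl fun i _ => ?_
  rw [integral_add .of_finite .of_finite, integral_const_mul, mul_comm (bias ν P i)]
  simp [bias, stdCoord]

lemma integral_linearPart_self (P : Measure (Cube n)) : ∫ x, linearPart ν P x ∂ν = 0 := by
  rw [integral_linearPart]
  simp [bias, integral_stdCoord]

lemma integral_stdCoord_mul (hν : IsProductMeasure ν) (hfix : NoFixedCoord ν) (i j : Fin n) :
    ∫ x, stdCoord ν i x * stdCoord ν j x ∂ν = if i = j then 1 else 0 := by
  split_ifs with hij
  · subst hij
    have h := one_sub_coordMean_sq_pos hν hfix i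
    have h1 (x : Cube n) : stdCoord ν i x * stdCoord ν i x =
        (1 + coordMean ν i ^ 2 - 2 * coordMean ν i * (((x i : ℤˣ) : ℤ) : ℝ)) /
          (1 - coordMean ν i ^ 2) := by
      rw [stdCoord, div_mul_div_comm, Real.mul_self_sqrt h.le]
      congr 1
      linear_combination sq_sign (x i)
    simp_rw [h1]
    rw [integral_div, integral_sub .of_finite .of_finite, integral_const_mul]
    have h2 : ∫ x, (((x i : ℤˣ) : ℤ) : ℝ) ∂ν = coordMean ν i := rfl
    rw [h2, div_eq_one_iff_eq h.ne']
    simp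
    ring
  · have h := integral_mul_of_isProductMeasure hν hij
      (fun s => (((s : ℤ) : ℝ) - coordMean ν i) / √(1 - coordMean ν i ^ 2))
      (fun s => (((s : ℤ) : ℝ) - coordMean ν j) / √(1 - coordMean ν j ^ 2))
    have h0 := integral_stdCoord ν ν i
    rw [sub_self, zero_div] at h0
    simp only [stdCoord] at h0 ⊢
    rw [h, h0, zero_mul]

lemma integral_linearPart_mul (hν : IsProductMeasure ν) (hfix : NoFixedCoord ν)
    (P Q : Measure (Cube n)) :
    ∫ x, linearPart ν P x * linearPart ν Q x ∂ν = ∑ i, bias ν P i * bias ν Q i := by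
  simp only [linearPart, Finset.sum_mul_sum]
  rw [integral_finsetSum _ fun _ _ => .of_finite]
  refine Finset.sum_congr rfl fun i _ => ?_
  rw [integral_finsetSum _ fun _ _ => .of_finite]
  simp_rw [mul_mul_mul_comm]
  simp [integral_const_mul, integral_stdCoord_mul hν hfix]

end Cube

/-! ### Measurability of the densities in the parameter -/

section Measurability

variable {n : ℕ} {S : Type*} [MeasurableSpace S]

lemma bias_mem_boundedMeasurable (ν : Measure (Cube n)) (D : Kernel S (Cube n)) [IsMarkovKernel D]
    (i : Fin n) : (fun u => bias ν (D u) i) ∈ boundedMeasurable S := by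
  have h (u : S) : bias ν (D u) i = ∑ x, (D u).real {x} * stdCoord ν i x :=
    integral_fintype .of_finite
  simp_rw [h]
  refine sum_mem_boundedMeasurable _ fun x _ => mul_mem_boundedMeasurable ?_
    (const_mem_boundedMeasurable _)
  exact ⟨(Kernel.measurable_coe D (measurableSet_singleton x)).ennreal_toReal, 1,
    fun u => by rw [abs_of_nonneg measureReal_nonneg]; exact measureReal_le_one⟩

lemma linearPart_mem_boundedMeasurable (ν : Measure (Cube n)) (D : Kernel S (Cube n))
    [IsMarkovKernel D] (x : Cube n) : (fun u => linearPart ν (D u) x) ∈ boundedMeasurable S :=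
  sum_mem_boundedMeasurable _ fun i _ => mul_mem_boundedMeasurable
    (bias_mem_boundedMeasurable ν D i) (const_mem_boundedMeasurable _)

lemma relDensity_mem_boundedMeasurable (ν : Measure (Cube n)) (D : Kernel S (Cube n))
    [IsMarkovKernel D] (x : Cube n) : (fun u => relDensity ν (D u) x) ∈ boundedMeasurable S := by
  simp only [relDensity, div_eq_mul_inv]
  refine mul_mem_boundedMeasurable ?_ (const_mem_boundedMeasurable _)
  exact ⟨(Kernel.measurable_coe D (measurableSet_singleton x)).ennreal_toReal, 1,
    fun u => by rw [abs_of_nonneg measureReal_nonneg]; exact measureReal_le_one⟩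

/-- The inner product of two averages is the average of the inner products. -/
lemma integral_integral_mul_integral {Y : Type*} [Fintype Y] [MeasurableSpace Y]
    [MeasurableSingletonClass Y] (ρ : Measure Y) [IsFiniteMeasure ρ] (μ : Measure S)
    [IsProbabilityMeasure μ] {f g : S → Y → ℝ} (hf : ∀ y, (f · y) ∈ boundedMeasurable S)
    (hg : ∀ y, (g · y) ∈ boundedMeasurable S) :
    ∫ y, (∫ u, f u y ∂μ) * (∫ v, g v y ∂μ) ∂ρ
      = ∫ p, (∫ y, f p.1 y * g p.2 y ∂ρ) ∂(μ.prod μ) := by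
  have h (p : S × S) : ∫ y, f p.1 y * g p.2 y ∂ρ = ∑ y, ρ.real {y} * (f p.1 y * g p.2 y) :=
    integral_fintype .of_finite
  simp_rw [h]
  rw [integral_fintype .of_finite, integral_finsetSum]
  · refine Finset.sum_congr rfl fun y _ => ?_
    rw [integral_const_mul, integral_prod_mul (f · y) (g · y), smul_eq_mul]
  · intro y _
    exact integrable_of_mem_boundedMeasurable (mul_mem_boundedMeasurable
      (const_mem_boundedMeasurable _) (mul_mem_boundedMeasurable
        (comp_mem_boundedMeasurable (hf y) measurable_fst)
        (comp_mem_boundedMeasurable (hg y) measurable_snd))) _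

end Measurability

/-! ### Low-degree functions of several samples -/

section LowDegree

lemma inner_toL2 {X : Type*} [MeasurableSpace X] [Finite X] [DiscreteMeasurableSpace X]
    (ν : Measure X) [IsFiniteMeasure ν] (f g : X → ℝ) :
    inner ℝ (toL2 ν f) (toL2 ν g) = ∫ x, f x * g x ∂ν := by
  rw [L2.inner_def]
  refine integral_congr_ae ?_
  filter_upwards [(MemLp.of_discrete : MemLp f 2 ν).coeFn_toLp,
    (MemLp.of_discrete : MemLp g 2 ν).coeFn_toLp] with x hf hg
  have hf' : (toL2 ν f) x = f x := hf
  have hg' : (toL2 ν g) x = g x := hg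
  rw [hf', hg']
  simp [mul_comm]

lemma norm_toL2_sq {X : Type*} [MeasurableSpace X] [Finite X] [DiscreteMeasurableSpace X]
    (ν : Measure X) [IsFiniteMeasure ν] (f : X → ℝ) :
    ‖toL2 ν f‖ ^ 2 = ∫ x, f x * f x ∂ν := by
  rw [← real_inner_self_eq_norm_sq, inner_toL2]

lemma integral_mem_submodule {Y S : Type*} [Fintype Y] [MeasurableSpace S] (μ : Measure S)
    [IsProbabilityMeasure μ] (W : Submodule ℝ (Y → ℝ)) {f : S → Y → ℝ} (hfW : ∀ u, f u ∈ W)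
    (hf : ∀ y, Integrable (f · y) μ) : (fun y => ∫ u, f u y ∂μ) ∈ W := by
  have h : ∫ u, f u ∂μ ∈ (W : Set (Y → ℝ)) :=
    W.convex.integral_mem W.closed_of_finiteDimensional
      (Filter.Eventually.of_forall hfW) (Integrable.of_eval hf)
  have h2 : (fun y => ∫ u, f u y ∂μ) = ∫ u, f u ∂μ := by
    ext y
    exact (eval_integral hf y).symm
  rw [h2]
  exact h

/-- A product over few samples of one affine function has samplewise degree `(1, k)`. -/
lemma prod_affine_mem_samplewiseDegree {n m k : ℕ} (c₀ : ℝ) (c : Fin n → ℝ) (T : Finset (Fin m))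
    (hT : T.card ≤ k) :
    (fun x : Fin m → Cube n => ∏ t ∈ T, (c₀ + ∑ i, c i * (((x t i : ℤˣ) : ℤ) : ℝ)))
      ∈ samplewiseDegree n m 1 k := by
  classical
  -- The index `none` stands for the constant monomial, the only one used outside `T`.
  let C : Fin m → Option (Fin n) → ℝ := fun t o =>
    if t ∈ T then o.elim c₀ c else o.elim 1 fun _ => 0
  let M : Option (Fin n) → Cube n → ℝ := fun o x => o.elim 1 fun i => (((x i : ℤˣ) : ℤ) : ℝ)
  have h1 : (fun x : Fin m → Cube n => ∏ t ∈ T, (c₀ + ∑ i, c i * (((x t i : ℤˣ) : ℤ) : ℝ)))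
      = ∑ o : Fin m → Option (Fin n), (∏ t, C t (o t)) • fun x => ∏ t, M (o t) (x t) := by
    ext x
    have h2 : ∏ t ∈ T, (c₀ + ∑ i, c i * (((x t i : ℤˣ) : ℤ) : ℝ))
        = ∏ t, ∑ o, C t o * M o (x t) := by
      rw [← Finset.prod_subset (Finset.subset_univ T)]
      · refine Finset.prod_congr rfl fun t ht => ?_
        simp [C, M, ht, Fintype.sum_option]
      · intro t _ ht
        simp [C, M, ht, Fintype.sum_option]
    rw [h2, Finset.prod_univ_sum, Fintype.piFinset_univ, Finset.sum_apply]
    simp [Finset.prod_mul_distrib]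
  rw [h1]
  refine Submodule.sum_mem _ fun o _ => ?_
  by_cases ho : ∃ t, t ∉ T ∧ o t ≠ none
  · obtain ⟨t, ht, hot⟩ := ho
    rw [Finset.prod_eq_zero (Finset.mem_univ t), zero_smul]
    · exact Submodule.zero_mem _
    · obtain ⟨i, hi⟩ := Option.ne_none_iff_exists'.1 hot
      simp [C, ht, hi]
  · push Not at ho
    refine Submodule.smul_mem _ _ (Submodule.subset_span
      ⟨fun t i => if o t = some i then 1 else 0, fun t => ?_, ?_, ?_⟩)
    · rcases h : o t with _ | i <;> simp [h]
    · refine le_trans ?_ hT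
      rw [← Set.ncard_coe_finset]
      refine Set.ncard_le_ncard (fun t ht => ?_) T.finite_toSet
      by_contra htT
      exact ht (by simp [ho t (by simpa using htT)])
    · ext x
      refine Finset.prod_congr rfl fun t _ => ?_
      cases h : o t with
      | none => simp [M, h]
      | some i => simp [M, h, pow_ite]

/-- A low-degree function `g` such that `f - g` is orthogonal to `g` has norm at most that of the
low-degree part of `f`. -/
lemma integral_sq_le_of_integral_mul_eq {n m d k : ℕ} (ν : Measure (Cube n))
    [IsProbabilityMeasure ν] {f g : (Fin m → Cube n) → ℝ} (hg : g ∈ samplewiseDegree n m d k)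
    (hfg : ∫ x, f x * g x ∂(samples m ν) = ∫ x, g x * g x ∂(samples m ν)) {ε : ℝ}
    (hε : ‖lowDegreePart ν d k f‖ ≤ ε) :
    ∫ x, g x * g x ∂(samples m ν) ≤ ε ^ 2 := by
  set W := (samplewiseDegree n m d k).map (toL2 (samples m ν))
  have hgW : toL2 (samples m ν) g ∈ W := Submodule.mem_map_of_mem hg
  have h1 : inner ℝ (lowDegreePart ν d k f) (toL2 (samples m ν) g)
      = ∫ x, g x * g x ∂(samples m ν) := by
    rw [← hfg, ← inner_toL2, lowDegreePart, Submodule.inner_starProjection_left_eq_right,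
      Submodule.starProjection_eq_self_iff.2 hgW]
  have h2 := real_inner_le_norm (lowDegreePart ν d k f) (toL2 (samples m ν) g)
  rw [h1, ← norm_toL2_sq] at h2
  rw [← norm_toL2_sq]
  have h3 : ‖toL2 (samples m ν) g‖ ≤ ε := by
    rcases (norm_nonneg (toL2 (samples m ν) g)).eq_or_lt with h | h
    · rw [← h]
      exact (norm_nonneg _).trans hε
    · nlinarith
  gcongr

end LowDegree

/-! ### Moments of the overlap of two random members of the family -/

section Moments

variable {n : ℕ}

/-- The inner product of the degree-one parts of the relative densities of `P` and `Q`. -/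
noncomputable def overlap (ν P Q : Measure (Cube n)) : ℝ := ∑ i, bias ν P i * bias ν Q i

/-- The component of `∏ t, relDensity ν P (x t)` that has degree exactly one in each of exactly `j`
samples. -/
noncomputable def linearComponent (ν P : Measure (Cube n)) {m : ℕ} (j : ℕ)
    (x : Fin m → Cube n) : ℝ :=
  ∑ T ∈ Finset.powersetCard j Finset.univ, ∏ t ∈ T, linearPart ν P (x t)

lemma linearComponent_mem_samplewiseDegree (ν P : Measure (Cube n)) {m j k : ℕ} (hjk : j ≤ k) :
    linearComponent ν P j ∈ samplewiseDegree n m 1 k := by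
  have h : (linearComponent ν P j : (Fin m → Cube n) → ℝ) =
      ∑ T ∈ Finset.powersetCard j Finset.univ, fun x => ∏ t ∈ T, linearPart ν P (x t) := by
    ext x
    simp [linearComponent]
  rw [h]
  refine Submodule.sum_mem _ fun T hT => ?_
  have h2 (x : Cube n) : linearPart ν P x =
      (∑ i, bias ν P i * (-coordMean ν i / √(1 - coordMean ν i ^ 2))) +
        ∑ i, bias ν P i / √(1 - coordMean ν i ^ 2) * (((x i : ℤˣ) : ℤ) : ℝ) := by
    rw [linearPart, ← Finset.sum_add_distrib]
    refine Finset.sum_congr rfl fun i _ => ?_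
    rw [stdCoord]
    ring
  simp_rw [h2]
  exact prod_affine_mem_samplewiseDegree _ _ T ((Finset.mem_powersetCard.1 hT).2.le.trans hjk)

variable {ν : Measure (Cube n)} [IsProbabilityMeasure ν]

lemma integral_samples_prod {m : ℕ} (f : Fin m → Cube n → ℝ) :
    ∫ x, ∏ t, f t (x t) ∂(samples m ν) = ∏ t, ∫ x, f t x ∂ν := by
  rw [samples, integral_fintype_prod_eq_prod]

lemma integral_prod_linearPart_mul (hν : IsProductMeasure ν) (hfix : NoFixedCoord ν)
    (P Q : Measure (Cube n)) {m : ℕ} (T T' : Finset (Fin m)) :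
    ∫ x, (∏ t ∈ T, linearPart ν P (x t)) * ∏ t ∈ T', linearPart ν Q (x t) ∂(samples m ν)
      = if T = T' then overlap ν P Q ^ T.card else 0 := by
  have h1 (x : Fin m → Cube n) :
      (∏ t ∈ T, linearPart ν P (x t)) * ∏ t ∈ T', linearPart ν Q (x t)
        = ∏ t, (if t ∈ T then linearPart ν P (x t) else 1) *
          (if t ∈ T' then linearPart ν Q (x t) else 1) := by
    rw [Finset.prod_mul_distrib]
    simp only [Finset.prod_ite_mem, Finset.univ_inter]
  simp_rw [h1]
  rw [integral_samples_prod fun t x => (if t ∈ T then linearPart ν P x else 1) *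
    (if t ∈ T' then linearPart ν Q x else 1)]
  split_ifs with h
  · subst h
    rw [← Finset.prod_subset (Finset.subset_univ T) fun t _ ht => by simp [ht],
      ← Finset.prod_const]
    refine Finset.prod_congr rfl fun t ht => ?_
    simpa [ht, overlap] using integral_linearPart_mul hν hfix P Q
  · obtain ⟨t, ht⟩ : ∃ t, ¬(t ∈ T ↔ t ∈ T') := by
      by_contra! hT
      exact h (Finset.ext hT)
    refine Finset.prod_eq_zero (Finset.mem_univ t) ?_
    by_cases hT : t ∈ T
    · have hT' : t ∉ T' := fun h' => ht (by simp [hT, h'])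
      simpa [hT, hT'] using integral_linearPart_self P
    · have hT' : t ∈ T' := by
        by_contra h'
        exact ht (by simp [hT, h'])
      simpa [hT, hT'] using integral_linearPart_self Q

lemma integral_prod_relDensity_mul (hν : IsProductMeasure ν) (hfix : NoFixedCoord ν)
    (P Q : Measure (Cube n)) [IsProbabilityMeasure P] {m : ℕ} (T : Finset (Fin m)) :
    ∫ x, (∏ t, relDensity ν P (x t)) * ∏ t ∈ T, linearPart ν Q (x t) ∂(samples m ν)
      = overlap ν P Q ^ T.card := by
  have h1 (x : Fin m → Cube n) :
      (∏ t, relDensity ν P (x t)) * ∏ t ∈ T, linearPart ν Q (x t)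
        = ∏ t, relDensity ν P (x t) * (if t ∈ T then linearPart ν Q (x t) else 1) := by
    rw [Finset.prod_mul_distrib]
    simp only [Finset.prod_ite_mem, Finset.univ_inter]
  simp_rw [h1]
  rw [integral_samples_prod fun t x => relDensity ν P x * (if t ∈ T then linearPart ν Q x else 1),
    ← Finset.prod_subset (Finset.subset_univ T), ← Finset.prod_const]
  · refine Finset.prod_congr rfl fun t ht => ?_
    simp only [ht, if_true]
    rw [integral_relDensity_mul hν hfix, integral_linearPart, overlap]
    exact Finset.sum_congr rfl fun i _ => mul_comm _ _
  · intro t _ ht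
    simpa [ht] using integral_relDensity hν hfix P

lemma integral_linearComponent_mul (hν : IsProductMeasure ν) (hfix : NoFixedCoord ν)
    (P Q : Measure (Cube n)) (m j : ℕ) :
    ∫ x, linearComponent ν P j x * linearComponent ν Q j x ∂(samples m ν)
      = m.choose j * overlap ν P Q ^ j := by
  simp only [linearComponent, Finset.sum_mul_sum]
  rw [integral_finsetSum _ fun _ _ => .of_finite]
  have h (T : Finset (Fin m)) (hT : T ∈ Finset.powersetCard j Finset.univ) :
      ∫ x, ∑ T' ∈ Finset.powersetCard j Finset.univ,
        (∏ t ∈ T, linearPart ν P (x t)) * ∏ t ∈ T', linearPart ν Q (x t) ∂(samples m ν)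
        = overlap ν P Q ^ j := by
    rw [integral_finsetSum _ fun _ _ => .of_finite]
    simp_rw [integral_prod_linearPart_mul hν hfix]
    rw [Finset.sum_ite_eq, if_pos hT, (Finset.mem_powersetCard.1 hT).2]
  rw [Finset.sum_congr rfl h]
  simp

lemma integral_prod_relDensity_mul_linearComponent (hν : IsProductMeasure ν)
    (hfix : NoFixedCoord ν) (P Q : Measure (Cube n)) [IsProbabilityMeasure P] (m j : ℕ) :
    ∫ x, (∏ t, relDensity ν P (x t)) * linearComponent ν Q j x ∂(samples m ν)
      = m.choose j * overlap ν P Q ^ j := by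
  simp only [linearComponent, Finset.mul_sum]
  rw [integral_finsetSum _ fun _ _ => .of_finite]
  simp_rw [integral_prod_relDensity_mul hν hfix P Q]
  rw [Finset.sum_congr rfl fun T hT => by rw [(Finset.mem_powersetCard.1 hT).2]]
  simp

lemma integral_linearComponent (hν : IsProductMeasure ν) (hfix : NoFixedCoord ν)
    (P : Measure (Cube n)) (m : ℕ) {j : ℕ} (hj : 1 ≤ j) :
    ∫ x, linearComponent ν P j x ∂(samples m ν) = 0 := by
  simp only [linearComponent]
  rw [integral_finsetSum _ fun _ _ => .of_finite]
  refine Finset.sum_eq_zero fun T hT => ?_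
  have h := integral_prod_linearPart_mul hν hfix P P T ∅
  have hT0 : T ≠ ∅ := by
    rintro rfl
    have := (Finset.mem_powersetCard.1 hT).2
    simp only [Finset.card_empty] at this
    omega
  simpa [hT0] using h

variable {S : Type*} [MeasurableSpace S] (μ : Measure S) [IsProbabilityMeasure μ]
  (D : Kernel S (Cube n)) [IsMarkovKernel D]

/-- The low-degree likelihood ratio dominates its components of degree one in each of exactly `j`
samples, whose squared norms are multiples of the moments of the overlap. -/
lemma choose_mul_integral_overlap_pow_le (hν : IsProductMeasure ν) (hfix : NoFixedCoord ν)
    {m k j : ℕ} (hj : 1 ≤ j) (hjk : j ≤ k) {ε : ℝ} (hε : LDLR ν D μ m 1 k ≤ ε) :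
    m.choose j * ∫ p, overlap ν (D p.1) (D p.2) ^ j ∂(μ.prod μ) ≤ ε ^ 2 := by
  set g : (Fin m → Cube n) → ℝ := fun x => ∫ u, linearComponent ν (D u) j x ∂μ with hg
  have hL (x : Fin m → Cube n) : (fun u => linearComponent ν (D u) j x) ∈ boundedMeasurable S :=
    sum_mem_boundedMeasurable _ fun T _ => prod_mem_boundedMeasurable _ fun t _ =>
      linearPart_mem_boundedMeasurable ν D (x t)
  have hR (x : Fin m → Cube n) :
      (fun u => ∏ t, relDensity ν (D u) (x t)) ∈ boundedMeasurable S :=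
    prod_mem_boundedMeasurable _ fun t _ => relDensity_mem_boundedMeasurable ν D (x t)
  have hgg : ∫ x, g x * g x ∂(samples m ν)
      = m.choose j * ∫ p, overlap ν (D p.1) (D p.2) ^ j ∂(μ.prod μ) := by
    rw [hg, integral_integral_mul_integral (samples m ν) μ hL hL]
    simp_rw [integral_linearComponent_mul hν hfix]
    rw [integral_const_mul]
  have hgW : g ∈ samplewiseDegree n m 1 k :=
    integral_mem_submodule μ _ (fun u => linearComponent_mem_samplewiseDegree ν (D u) hjk)
      fun x => integrable_of_mem_boundedMeasurable (hL x) μ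
  have hg0 : ∫ x, g x ∂(samples m ν) = 0 := by
    have h := integral_integral_mul_integral (samples m ν) μ
      (f := fun _ _ => (1 : ℝ)) (fun _ => const_mem_boundedMeasurable _) hL
    simpa [integral_linearComponent hν hfix _ m hj] using h
  have hfg : ∫ x, (mixtureLR ν D μ m - 1) x * g x ∂(samples m ν)
      = ∫ x, g x * g x ∂(samples m ν) := by
    simp only [Pi.sub_apply, Pi.one_apply, sub_mul, one_mul]
    rw [integral_sub .of_finite .of_finite, hg0, sub_zero, hgg]
    simp only [mixtureLR, hg]
    rw [integral_integral_mul_integral (samples m ν) μ hR hL]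
    simp_rw [integral_prod_relDensity_mul_linearComponent hν hfix]
    rw [integral_const_mul]
  rw [← hgg]
  exact integral_sq_le_of_integral_mul_eq ν hgW hfg hε

lemma norm_mixtureLR_sq (t : ℕ) :
    ‖toL2 (samples t ν) (mixtureLR ν D μ t)‖ ^ 2
      = ∫ p, innerL2 ν (relDensity ν (D p.1)) (relDensity ν (D p.2)) ^ t ∂(μ.prod μ) := by
  have hR (x : Fin t → Cube n) :
      (fun u => ∏ j, relDensity ν (D u) (x j)) ∈ boundedMeasurable S :=
    prod_mem_boundedMeasurable _ fun j _ => relDensity_mem_boundedMeasurable ν D (x j)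
  rw [norm_toL2_sq]
  simp only [mixtureLR]
  rw [integral_integral_mul_integral (samples t ν) μ hR hR]
  simp_rw [← Finset.prod_mul_distrib]
  refine integral_congr_ae (Filter.Eventually.of_forall fun p => ?_)
  simp only
  rw [integral_samples_prod fun _ x => relDensity ν (D p.1) x * relDensity ν (D p.2) x]
  simp [innerL2]

end Moments

/-! ### The statistical dimension -/

section StatisticalDimension

variable {n : ℕ} {S : Type*} [MeasurableSpace S]

lemma overlap_mem_positiveKernels (ν : Measure (Cube n)) (D : Kernel S (Cube n))
    [IsMarkovKernel D] :
    (fun p : S × S => overlap ν (D p.1) (D p.2)) ∈ positiveKernels S := by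
  have h := (positiveKernels S).sum_mem (t := Finset.univ) fun i _ =>
    mul_self_mem_positiveKernels (bias_mem_boundedMeasurable ν D i)
  convert h using 1
  ext p
  simp [overlap]

/-- The inner products of pairs of relative densities, expanded over the coordinates, in the order
given by the cone of positive-definite kernels. -/
lemma innerL2_relDensity_mem_positiveKernels {ν : Measure (Cube n)} [IsProbabilityMeasure ν]
    (D : Kernel S (Cube n)) [IsMarkovKernel D] (hν : IsProductMeasure ν) (hfix : NoFixedCoord ν)
    (hD : ∀ u, IsProductMeasure (D u)) {y P : S × S → ℝ}
    (hy : y = fun p => overlap ν (D p.1) (D p.2))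
    (hP : P = fun p => innerL2 ν (relDensity ν (D p.1)) (relDensity ν (D p.2))) :
    P - 1 ∈ positiveKernels S ∧ P - 1 - y ∈ positiveKernels S ∧
      y * P - (P - 1) ∈ positiveKernels S ∧ y ^ 2 * P - (P - 1 - y) ∈ positiveKernels S := by
  have h := prod_one_add_mem_cone (positiveKernels S) Finset.univ
    (fun i p => bias ν (D p.1) i * bias ν (D p.2) i) fun i _ =>
      mul_self_mem_positiveKernels (bias_mem_boundedMeasurable ν D i)
  have hP' : P = ∏ i, (1 + fun p : S × S => bias ν (D p.1) i * bias ν (D p.2) i) := by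
    ext p
    simp [hP, innerL2_relDensity hν hfix (hD p.1) (hD p.2)]
  have hy' : y = ∑ i, fun p : S × S => bias ν (D p.1) i * bias ν (D p.2) i := by
    ext p
    simp [hy, overlap]
  rw [hP', hy']
  exact h

end StatisticalDimension

theorem theorem6p3 {S : Type*} [MeasurableSpace S] (μ : Measure S) [IsProbabilityMeasure μ]
    (n : ℕ) (ν : Measure (Cube n)) [IsProbabilityMeasure ν]
    (D : Kernel S (Cube n)) [IsMarkovKernel D]
    (hν : IsProductMeasure ν) (hfix : NoFixedCoord ν) (hD : ∀ u, IsProductMeasure (D u))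
    (k : ℕ) (hk : 0 < k) (hkeven : Even k) (m : ℕ) (hm : 2 ≤ m)
    (C ε : ℝ) (hC : 0 ≤ C) (hε : 0 < ε)
    (hLR : ‖toL2 (samples (2 * k) ν) (mixtureLR ν D μ (2 * k))‖ ^ 2 ≤ C ^ k)
    (hLDLR : LDLR ν D μ m 1 (4 * k) ≤ ε)
    (q : ℕ) (hq : 1 ≤ q) :
    (q : ℕ∞) ≤ SDA ν D μ
      (m / ((q : ℝ) ^ (2 / k : ℝ) * ε ^ (1 / k : ℝ) * k)
        * (1 / (ε ^ (1 / k : ℝ) + 16 * k * C ^ (1 / 2 : ℝ) / m))) := by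
  refine le_iSup₂_of_le q (fun A _ hA => ?_) le_rfl
  -- The overlap `y`, the inner product `P`, and the part `r` of `P` of degree at least two.
  set y : S × S → ℝ := fun p => overlap ν (D p.1) (D p.2) with hy
  set P : S × S → ℝ := fun p => innerL2 ν (relDensity ν (D p.1)) (relDensity ν (D p.2)) with hP
  obtain ⟨hX, hr, hyP, hy2P⟩ := innerL2_relDensity_mem_positiveKernels D hν hfix hD hy hP
  have hyK : y ∈ positiveKernels S := overlap_mem_positiveKernels ν D
  have hPK : P ∈ positiveKernels S := by simpa using add_mem hX (one_mem _)
  have bdd {F : S × S → ℝ} (hF : F ∈ positiveKernels S) := positiveKernels_le_boundedMeasurable hF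
  set E := ε ^ (1 / k : ℝ)
  set Q := (q : ℝ) ^ (2 / k : ℝ)
  have hE0 : 0 < E := Real.rpow_pos_of_pos hε _
  have hQ0 : 0 < Q := Real.rpow_pos_of_pos (by exact_mod_cast hq) _
  have hEk : E ^ k = ε := by
    rw [← Real.rpow_natCast, ← Real.rpow_mul hε.le, one_div_mul_cancel (by positivity),
      Real.rpow_one]
  have hm0 : (0 : ℝ) < m := by exact_mod_cast (by omega : 0 < m)
  have hk0 : (0 : ℝ) < k := by exact_mod_cast hk
  have hsqrt : √(C ^ k) = √C ^ k := by
    rw [Real.sqrt_eq_iff_mul_self_eq (by positivity) (by positivity), ← mul_pow,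
      Real.mul_self_sqrt hC]
  rw [← Real.sqrt_eq_rpow]
  have hM : 1 / (m / (Q * E * k) * (1 / (E + 16 * k * √C / m)))
      = Q * (E ^ 2 * (k / m)) + Q * (E * (16 * k ^ 2 * √C / m ^ 2)) := by
    have : 0 < E + 16 * k * √C / m := by positivity
    field_simp
  rw [hM]
  have hPC : √(∫ p, (P p ^ k) ^ 2 ∂(μ.prod μ)) ≤ √C ^ k := by
    rw [← hsqrt]
    refine Real.sqrt_le_sqrt (le_trans (le_of_eq ?_) hLR)
    rw [norm_mixtureLR_sq]
    simp_rw [← pow_mul, mul_comm k 2, hP]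
  have hmoment {j : ℕ} (hj : 1 ≤ j) (hj4 : j ≤ 4 * k) :
      m.choose j * ∫ p, y p ^ j ∂(μ.prod μ) ≤ ε ^ 2 :=
    choose_mul_integral_overlap_pow_le μ D hν hfix hj hj4 hLDLR
  have hmoment' {j : ℕ} (hj : 1 ≤ j) (hj4 : j ≤ 4 * k) (hjm : j ≤ m) :
      ∫ p, y p ^ j ∂(μ.prod μ) ≤ ε ^ 2 * (j / m : ℝ) ^ j := by
    have hj0 : (0 : ℝ) < j := by exact_mod_cast hj
    have h0 : 0 ≤ ∫ p, y p ^ j ∂(μ.prod μ) :=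
      integral_nonneg_of_mem_positiveKernels (pow_mem hyK j) μ
    have h1 := (mul_le_mul_of_nonneg_right (div_pow_le_choose m j hjm) h0).trans (hmoment hj hj4)
    calc ∫ p, y p ^ j ∂(μ.prod μ)
        = (m / j : ℝ) ^ j * (∫ p, y p ^ j ∂(μ.prod μ)) * (j / m : ℝ) ^ j := by
          rw [mul_right_comm, ← mul_pow, div_mul_div_cancel₀ hj0.ne', div_self hm0.ne', one_pow,
            one_mul]
      _ ≤ _ := mul_le_mul_of_nonneg_right h1 (by positivity)
  set B := E * (16 * k ^ 2 * √C / m ^ 2)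
  have hB0 : 0 ≤ B := by positivity
  have hBk : B ^ k = ε * ((4 * k / m : ℝ) ^ (2 * k) * √C ^ k) := by
    rw [mul_pow, hEk, pow_mul, ← mul_pow]
    congr 2
    ring
  by_cases hkm : 4 * k ≤ m
  · -- All the moments of `y` up to order `4 * k` are controlled, so `y` and `r` can be bounded
    -- separately.
    have hyk : ∫ p, y p ^ k ∂(μ.prod μ) ≤ (E ^ 2 * (k / m)) ^ k := by
      rw [mul_pow, ← pow_mul, mul_comm 2 k, pow_mul, hEk]
      exact hmoment' hk (by omega) (by omega)
    have hrk : ∫ p, (P - 1 - y) p ^ k ∂(μ.prod μ) ≤ B ^ k := by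
      have h1 := integral_mono_of_sub_mem_positiveKernels (bdd (pow_mem hr k))
        (bdd (pow_mem (mul_mem (pow_mem hyK 2) hPK) k)) (pow_sub_pow_mem_cone _ hr hy2P k) μ
      have h2 := integral_mul_le_sqrt_mul_sqrt (bdd (pow_mem hyK (2 * k))) (bdd (pow_mem hPK k))
        (μ.prod μ)
      have h3 : √(∫ p, (y ^ (2 * k)) p ^ 2 ∂(μ.prod μ)) ≤ ε * (4 * k / m : ℝ) ^ (2 * k) := by
        refine Real.sqrt_le_iff.2 ⟨by positivity, ?_⟩
        have h := hmoment' (j := 4 * k) (by omega) le_rfl hkm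
        push_cast at h
        rw [mul_pow, ← pow_mul, show 2 * k * 2 = 4 * k by ring]
        simpa only [Pi.pow_apply, ← pow_mul, show 2 * k * 2 = 4 * k by ring] using h
      refine (h1.trans (le_of_eq ?_)).trans (h2.trans ((mul_le_mul h3 hPC
        (Real.sqrt_nonneg _) (by positivity)).trans (le_of_eq ?_)))
      · simp only [mul_pow, ← pow_mul, Pi.mul_apply, Pi.pow_apply]
      · rw [hBk]
        ring
    have hi1 := integral_abs_cond_le (bdd hyK) hk hkeven hq (by positivity) hyk hA
    have hi2 := integral_abs_cond_le (bdd hr) hk hkeven hq hB0 hrk hA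
    refine le_trans ?_ (add_le_add hi1 hi2)
    have hint {F : S × S → ℝ} (hF : F ∈ positiveKernels S) :
        Integrable (fun p => |F p|) ((μ.prod μ)[|A]) :=
      integrable_of_mem_boundedMeasurable (abs_mem_boundedMeasurable (bdd hF)) _
    rw [← integral_add (hint hyK) (hint hr)]
    refine integral_mono (hint hX) ((hint hyK).add (hint hr)) fun p => ?_
    have h := abs_add_le (y p) ((P - 1 - y) p)
    simpa using h
  · -- Now `4 * k / m > 1`, and the second moment of `y` suffices, as `P - 1 ≤ P` and
    -- `P - 1 ≤ y * P` give `(P - 1) ^ k ≤ y * P ^ k`.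
    have hXk : ∫ p, (P - 1) p ^ k ∂(μ.prod μ) ≤ B ^ k := by
      obtain ⟨l, rfl⟩ : ∃ l, k = l + 1 := ⟨k - 1, by omega⟩
      have h0 : y * P ^ (l + 1) - (P - 1) ^ (l + 1) ∈ positiveKernels S := by
        have h1 : P ^ l - (P - 1) ^ l ∈ positiveKernels S :=
          pow_sub_pow_mem_cone _ hX (by simp) l
        rw [show y * P ^ (l + 1) - (P - 1) ^ (l + 1)
          = (y * P - (P - 1)) * P ^ l + (P - 1) * (P ^ l - (P - 1) ^ l) by ring]
        exact add_mem (mul_mem hyP (pow_mem hPK l)) (mul_mem hX h1)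
      have h1 := integral_mono_of_sub_mem_positiveKernels (bdd (pow_mem hX (l + 1)))
        (bdd (mul_mem hyK (pow_mem hPK (l + 1)))) h0 μ
      have h2 := integral_mul_le_sqrt_mul_sqrt (bdd hyK) (bdd (pow_mem hPK (l + 1))) (μ.prod μ)
      have h3 : √(∫ p, y p ^ 2 ∂(μ.prod μ)) ≤ ε := by
        refine Real.sqrt_le_iff.2 ⟨hε.le, ?_⟩
        have h := hmoment (j := 2) (by omega) (by omega)
        refine le_trans (le_mul_of_one_le_left (integral_nonneg fun p => sq_nonneg _) ?_) h
        exact_mod_cast Nat.choose_pos hm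
      have h4 : (1 : ℝ) ≤ (4 * (l + 1 : ℕ) / m : ℝ) ^ (2 * (l + 1)) := by
        refine one_le_pow₀ ((one_le_div hm0).2 ?_)
        exact_mod_cast (not_le.1 hkm).le
      refine h1.trans (h2.trans ((mul_le_mul h3 hPC (Real.sqrt_nonneg _) hε.le).trans ?_))
      rw [hBk]
      exact mul_le_mul_of_nonneg_left (le_mul_of_one_le_left (by positivity) h4) hε.le
    have hi := integral_abs_cond_le (bdd hX) hk hkeven hq hB0 hXk hA
    exact hi.trans (le_add_of_nonneg_left (by positivity))
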